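/- Let $G$ be a Lie group (of dimension $5$) whose Lie algebra $\mathfrak g$ is isomorphic to $A_{3,1}\oplus 2A_1$, that is, $\mathfrak g$ has a basis $e_1,\dots,e_5$ whose only non-zero commutation relation (up to antisymmetry) is $[e_1,e_2]=e_5$. Let $T$ be a left-invariant symmetric tensor field of type $(0,2)$ on $G$. Then there exists a pair $(g,t)$, where $g$ is a left-invariant Riemannian metric on $G$ and $t$ is a non-zero real number, such that $$\mathrm{Ric}(g)=t^2\,T,$$ where $\mathrm{Ric}(g)$ is the Ricci tensor of $g$, if and only if there exist an inner product $\langle\cdot,\cdot\rangle$ on $\mathfrak g$, real numbers $\alpha>0$ and $\eta>0$, and a basis $\mathcal B_3=\{v_1,\dots,v_5\}$ of $\mathfrak g$ which is orthonormal with respect to $\eta\langle\cdot,\cdot\rangle$ and whose only non-zero commutation relation (up to antisymmetry) is $[v_1,v_2]=\alpha v_5$, such that the matrix $(T(v_i,v_j))_{i,j}$ of $T$ at the identity in $\mathcal B_3$ is $$\mathrm{diag}(a,b,0,0,c)$$ with real numbers $a,b,c$ satisfying $a<0$ and $a=b=-c$. -/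

import Mathlib

open Bundle Module VectorField
open scoped Manifold ContDiff

noncomputable section

namespace RicciLie

/-! ### Tensor fields and Riemannian metrics on a Lie group -/

section Tensors

variable {E : Type*} [NormedAddCommGroup E] [NormedSpace ℝ E]
  {G : Type*} [TopologicalSpace G] [ChartedSpace E G]

/-- A tensor field of type `(0,2)`: a bilinear form on every tangent space. No regularity is
imposed here, since only left-invariant tensor fields occur below, and those are smooth. -/
abbrev TensorField02 (E : Type*) [NormedAddCommGroup E] [NormedSpace ℝ E]
    (G : Type*) [TopologicalSpace G] [ChartedSpace E G] : Type _ :=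
  ∀ p : G, TangentSpace 𝓘(ℝ, E) p →L[ℝ] TangentSpace 𝓘(ℝ, E) p →L[ℝ] ℝ

/-- `S` is symmetric at every point. -/
def IsSymmetricTensor (S : TensorField02 E G) : Prop :=
  ∀ (p : G) (u v : TangentSpace 𝓘(ℝ, E) p), S p u v = S p v u

/-- `S` is invariant under all left translations `L_a : q ↦ a * q`, that is `L_a^* S = S`. -/
def IsLeftInvariant [Group G] (S : TensorField02 E G) : Prop :=
  ∀ (a p : G) (u v : TangentSpace 𝓘(ℝ, E) p),
    S (a * p) (mfderiv 𝓘(ℝ, E) 𝓘(ℝ, E) (fun q : G => a * q) p u)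
      (mfderiv 𝓘(ℝ, E) 𝓘(ℝ, E) (fun q : G => a * q) p v) = S p u v

/-- Smooth Riemannian metrics on `G`. -/
abbrev SmoothMetric (E : Type*) [NormedAddCommGroup E] [NormedSpace ℝ E]
    (G : Type*) [TopologicalSpace G] [ChartedSpace E G] [IsManifold 𝓘(ℝ, E) ∞ G] : Type _ :=
  ContMDiffRiemannianMetric 𝓘(ℝ, E) ∞ E (fun p : G => TangentSpace 𝓘(ℝ, E) p)

end Tensors

/-! ### Levi-Civita connection and curvature -/

section Connection

variable {E : Type*} [NormedAddCommGroup E] [NormedSpace ℝ E]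
  {G : Type*} [TopologicalSpace G] [ChartedSpace E G]

/-- Affine connections on `G`. Mathlib writes `nabla Y p (X p)` for `(∇_X Y)(p)`. -/
abbrev AffineConnection (E : Type*) [NormedAddCommGroup E] [NormedSpace ℝ E]
    (G : Type*) [TopologicalSpace G] [ChartedSpace E G] [IsManifold 𝓘(ℝ, E) ∞ G] : Type _ :=
  CovariantDerivative 𝓘(ℝ, E) E (fun p : G => TangentSpace 𝓘(ℝ, E) p)

/-- `nabla` is compatible with the Riemannian metric `g`:
`u · g(Y,Z) = g(∇_u Y, Z) + g(Y, ∇_u Z)` for all tangent vectors `u` and all vector fields `Y`, `Z`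
that are differentiable at the base point of `u`. -/
def IsCompatibleWithMetric [IsManifold 𝓘(ℝ, E) ∞ G] (g : SmoothMetric E G)
    (nabla : AffineConnection E G) : Prop :=
  ∀ (p : G) (u : TangentSpace 𝓘(ℝ, E) p) (Y Z : ∀ q : G, TangentSpace 𝓘(ℝ, E) q),
    MDiffAt (T% Y) p → MDiffAt (T% Z) p →
      mvfderiv 𝓘(ℝ, E) (fun q => g.inner q (Y q) (Z q)) p u =
        g.inner p (nabla Y p u) (Z p) + g.inner p (Y p) (nabla Z p u)

/-- `nabla` is the Levi-Civita connection of the Riemannian metric `g`: it has no torsion and is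
compatible with `g`. -/
def IsLeviCivita [CompleteSpace E] [FiniteDimensional ℝ E] [IsManifold 𝓘(ℝ, E) ∞ G]
    (g : SmoothMetric E G) (nabla : AffineConnection E G) : Prop :=
  nabla.torsion = 0 ∧ IsCompatibleWithMetric g nabla

/-- The curvature `R(X,Y)Z = ∇_X ∇_Y Z - ∇_Y ∇_X Z - ∇_{[X,Y]} Z` at the point `p`. -/
def curvature [IsManifold 𝓘(ℝ, E) ∞ G] (nabla : AffineConnection E G)
    (X Y Z : ∀ p : G, TangentSpace 𝓘(ℝ, E) p) (p : G) : TangentSpace 𝓘(ℝ, E) p :=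
  nabla (fun q => nabla Z q (Y q)) p (X p) - nabla (fun q => nabla Z q (X q)) p (Y p)
    - nabla Z p (mlieBracket 𝓘(ℝ, E) X Y p)

end Connection

/-! ### Ricci curvature on a Lie group -/

section Ricci

variable {E : Type*} [NormedAddCommGroup E] [NormedSpace ℝ E]
  {G : Type*} [TopologicalSpace G] [ChartedSpace E G] [Group G]

/-- The left-invariant vector field on `G` whose value at the point `p` is `u`: translate `u` to the
identity by `p⁻¹`, then take the associated left-invariant vector field. -/
def leftExtend (p : G) (u : TangentSpace 𝓘(ℝ, E) p) : ∀ q : G, TangentSpace 𝓘(ℝ, E) q :=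
  mulInvariantVectorField
    (mfderiv 𝓘(ℝ, E) 𝓘(ℝ, E) (fun q : G => p⁻¹ * q) p u : GroupLieAlgebra 𝓘(ℝ, E) G)

/-- The Ricci tensor `ric(u,v) = tr (w ↦ R(w,u)v)` at the point `p`. Tangent vectors are extended
to left-invariant vector fields in order to evaluate the curvature; as the curvature is a tensor,
any other smooth extensions give the same value. The trace is computed in a basis of the tangent
space at `p` and does not depend on the basis. -/
def ricci [FiniteDimensional ℝ E] [IsManifold 𝓘(ℝ, E) ∞ G] (nabla : AffineConnection E G)
    (p : G) (u v : TangentSpace 𝓘(ℝ, E) p) : ℝ :=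
  let b : Basis (Fin (finrank ℝ E)) ℝ (TangentSpace 𝓘(ℝ, E) p) := finBasis ℝ E
  ∑ i, b.coord i (curvature nabla (leftExtend p (b i)) (leftExtend p u) (leftExtend p v) p)

/-- `Ric(g) = S`: the Ricci tensor of the Levi-Civita connection of `g` is `S`. -/
def HasRicci [CompleteSpace E] [FiniteDimensional ℝ E] [IsManifold 𝓘(ℝ, E) ∞ G]
    (g : SmoothMetric E G) (S : TensorField02 E G) : Prop :=
  ∃ nabla : AffineConnection E G, IsLeviCivita g nabla ∧
    ∀ (p : G) (u v : TangentSpace 𝓘(ℝ, E) p), ricci nabla p u v = S p u v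

end Ricci

/-! ### The Lie algebra `A_{3,1} ⊕ 2A_1` and its adapted bases -/

section LieAlgebra

variable {L : Type*} [AddCommGroup L] [Module ℝ L]

/-- The basis `v = (v₁, …, v₅)` satisfies `[v₁, v₂] = α v₅ = -[v₂, v₁]` and all its other brackets
vanish. Indices start at `0`. -/
def HasHeisenbergBrackets [Bracket L L] (α : ℝ) (v : Basis (Fin 5) ℝ L) : Prop :=
  ∀ i j : Fin 5, ⁅v i, v j⁆ =
    if i = 0 ∧ j = 1 then α • v 4 else if i = 1 ∧ j = 0 then -(α • v 4) else 0

/-- `L` is isomorphic to `A_{3,1} ⊕ 2A_1`: it has a basis `e₁, …, e₅` whose only non-zero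
commutation relation is `[e₁, e₂] = e₅`. -/
def IsA31Plus2A1 (L : Type*) [AddCommGroup L] [Module ℝ L] [Bracket L L] : Prop :=
  ∃ e : Basis (Fin 5) ℝ L, HasHeisenbergBrackets 1 e

/-- `v` is an adapted basis `B_3` for the inner product `c` on `L`: for some `η > 0` it is
orthonormal with respect to `η c`, and for some `α > 0` its only non-zero commutation relation is
`[v₁, v₂] = α v₅`. -/
def IsAdaptedBasis [Bracket L L] (c : InnerProductSpace.Core ℝ L) (v : Basis (Fin 5) ℝ L) :
    Prop :=
  ∃ α η : ℝ, 0 < α ∧ 0 < η ∧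
    (∀ i j : Fin 5, η * c.inner (v i) (v j) = if i = j then 1 else 0) ∧
    HasHeisenbergBrackets α v

end LieAlgebra

end RicciLie

end

/-! A left-invariant metric is an inner product on the Lie algebra. Gram-Schmidt, run from the
centre outwards, turns the given basis into an orthonormal one with single bracket `[v₁, v₂] = α
v₅`, `α > 0` (`exists_orthonormal_hasHeisenbergBrackets`). In such a basis the Ricci tensor is
`diag(-α²/2, -α²/2, 0, 0, α²/2)` (`algRicci_heisenberg`), so every `T` with `Ric(g) = t² T` has the
stated shape. Conversely, given that shape, the metric making `v` orthonormal works, with `t² = α² /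
(2|a|)`.

Most of the work passes from fields on `G` to algebra. On left-invariant fields any Levi-Civita
connection has the Koszul coefficients (`IsLeviCivita.apply_frame`), so the Ricci tensor is a trace
on the Lie algebra (`ricci_eq_algRicci`). Since `HasRicci` asks for a connection, the converse also
needs existence (`isLeviCivita_frameConnection`) and smoothness of the metric
(`contMDiff_sumSqForm`). -/

open Bundle Module VectorField
open scoped Manifold ContDiff

noncomputable section

namespace RicciLie

/-! ### Left trivialization of the tangent bundle. -/

section LeftTrivialization

variable {E : Type*} [NormedAddCommGroup E] [NormedSpace ℝ E]
  {G : Type*} [TopologicalSpace G] [ChartedSpace E G] [Group G]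

/-- The left trivialization of the tangent bundle of a Lie group: translate a tangent vector at `p`
to the identity by `p⁻¹`. -/
def leftTriv (p : G) : TangentSpace 𝓘(ℝ, E) p →L[ℝ] GroupLieAlgebra 𝓘(ℝ, E) G :=
  mfderiv 𝓘(ℝ, E) 𝓘(ℝ, E) (fun q : G => p⁻¹ * q) p

/-- The inverse of the left trivialization: translate an element of the Lie algebra to `p`. -/
def leftTrivSymm (p : G) : GroupLieAlgebra 𝓘(ℝ, E) G →L[ℝ] TangentSpace 𝓘(ℝ, E) p :=
  mfderiv 𝓘(ℝ, E) 𝓘(ℝ, E) (fun q : G => p * q) 1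

theorem mulInvariantVectorField_eq_leftTrivSymm (x : GroupLieAlgebra 𝓘(ℝ, E) G) (p : G) :
    mulInvariantVectorField x p = leftTrivSymm p x := rfl

theorem leftExtend_eq (p : G) (u : TangentSpace 𝓘(ℝ, E) p) :
    leftExtend p u = mulInvariantVectorField (leftTriv p u) := rfl

variable [LieGroup 𝓘(ℝ, E) ∞ G]

theorem mdifferentiableAt_mul_left' (a p : G) :
    MDifferentiableAt 𝓘(ℝ, E) 𝓘(ℝ, E) (fun q : G => a * q) p :=
  (contMDiff_mul_left (I := 𝓘(ℝ, E)) (n := ∞)).contMDiffAt.mdifferentiableAt (by simp)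

theorem leftTriv_mfderiv_mul_left (a p : G) (u : TangentSpace 𝓘(ℝ, E) p) :
    leftTriv (a * p) (mfderiv 𝓘(ℝ, E) 𝓘(ℝ, E) (fun q : G => a * q) p u) = leftTriv p u := by
  have h := mfderiv_comp (I := 𝓘(ℝ, E)) (I' := 𝓘(ℝ, E)) (I'' := 𝓘(ℝ, E)) p
    (mdifferentiableAt_mul_left' (a * p)⁻¹ (a * p)) (mdifferentiableAt_mul_left' (E := E) a p)
  have e : (fun q : G => (a * p)⁻¹ * q) ∘ (fun q : G => a * q) = fun q => p⁻¹ * q := by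
    ext q; simp [mul_assoc]
  rw [e] at h
  exact (congrArg (fun f : E →L[ℝ] E => f u) h).symm

omit [LieGroup 𝓘(ℝ, E) ∞ G] in
theorem leftTriv_one (x : GroupLieAlgebra 𝓘(ℝ, E) G) : leftTriv (1 : G) x = x := by
  have e : (fun q : G => (1 : G)⁻¹ * q) = id := by ext q; simp
  have h : mfderiv 𝓘(ℝ, E) 𝓘(ℝ, E) (fun q : G => (1 : G)⁻¹ * q) 1 =
      mfderiv 𝓘(ℝ, E) 𝓘(ℝ, E) (id : G → G) 1 := by rw [e]
  rw [mfderiv_id] at h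
  exact congrArg (fun f : E →L[ℝ] E => f x) h

theorem leftTriv_leftTrivSymm (p : G) (x : GroupLieAlgebra 𝓘(ℝ, E) G) :
    leftTriv p (leftTrivSymm p x) = x := by
  have h := leftTriv_mfderiv_mul_left p 1 x
  rw [leftTriv_one] at h
  -- The derivative lives over `p * 1`, equal to `p` only propositionally. All tangent spaces are
  -- `E` by definition, so values are compared in `E` and the base point is substituted.
  have e : ∀ r : G, r = p →
    leftTriv r (mfderiv 𝓘(ℝ, E) 𝓘(ℝ, E) (fun q : G => p * q) 1 x : E) =
    leftTriv p (mfderiv 𝓘(ℝ, E) 𝓘(ℝ, E) (fun q : G => p * q) 1 x : E) := by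
    rintro r rfl; rfl
  exact (e _ (mul_one p)).symm.trans h

theorem leftTrivSymm_leftTriv (p : G) (u : TangentSpace 𝓘(ℝ, E) p) :
    leftTrivSymm p (leftTriv p u) = u := by
  have h := mfderiv_comp (I := 𝓘(ℝ, E)) (I' := 𝓘(ℝ, E)) (I'' := 𝓘(ℝ, E)) p
    (mdifferentiableAt_mul_left' p (p⁻¹ * p)) (mdifferentiableAt_mul_left' (E := E) p⁻¹ p)
  have e : (fun q : G => p * q) ∘ (fun q : G => p⁻¹ * q) = id := by
    ext q; simp
  rw [e, mfderiv_id] at h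
  have e : ∀ r : G, r = 1 →
    (mfderiv 𝓘(ℝ, E) 𝓘(ℝ, E) (fun q : G => p * q) r : E →L[ℝ] E) =
     (mfderiv 𝓘(ℝ, E) 𝓘(ℝ, E) (fun q : G => p * q) 1 : E →L[ℝ] E) := by
    rintro r rfl; rfl
  have h2 := congrArg (fun f : E →L[ℝ] E => f u) h
  refine Eq.trans ?_ h2.symm
  exact congrArg (fun f : E →L[ℝ] E => f (leftTriv p u)) (e _ (inv_mul_cancel p)).symm

/-- The left trivialization at `p` as a linear equivalence. -/
def leftTrivEquiv (p : G) : TangentSpace 𝓘(ℝ, E) p ≃ₗ[ℝ] GroupLieAlgebra 𝓘(ℝ, E) G :=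
  LinearEquiv.ofLinearMap (leftTriv p).toLinearMap (leftTrivSymm p).toLinearMap
    (LinearMap.ext fun x => leftTriv_leftTrivSymm p x)
    (LinearMap.ext fun u => leftTrivSymm_leftTriv p u)

/-- The map `(q, r) ↦ q⁻¹ r` is jointly smooth, hence so is its derivative in `r` taken along the
diagonal `r = q`. The target point is left as `q⁻¹ * q`. -/
theorem contMDiffAt_leftTriv_inTangentCoordinates (p : G) :
    ContMDiffAt 𝓘(ℝ, E) 𝓘(ℝ, E →L[ℝ] E) ∞
      (inTangentCoordinates 𝓘(ℝ, E) 𝓘(ℝ, E) id (fun q : G => q⁻¹ * q)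
        (fun q => mfderiv 𝓘(ℝ, E) 𝓘(ℝ, E) (fun r : G => q⁻¹ * r) q) p) p := by
  refine ContMDiffAt.mfderiv (n := ∞) (fun q r : G => q⁻¹ * r) id ?_ contMDiffAt_id (by simp)
  have h1 : ContMDiff (𝓘(ℝ, E).prod 𝓘(ℝ, E)) 𝓘(ℝ, E) ∞ (fun x : G × G => x.1⁻¹ * x.2) :=
    (contMDiff_fst.inv).mul contMDiff_snd
  exact h1.contMDiffAt

end LeftTrivialization

/-! ### Smoothness of left-invariant forms. -/

section Coframe

variable {E : Type*} [NormedAddCommGroup E] [NormedSpace ℝ E]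
  {G : Type*} [TopologicalSpace G] [ChartedSpace E G] [Group G]

/-- The left-invariant one-form with value `l` at the identity. -/
def leftForm (l : GroupLieAlgebra 𝓘(ℝ, E) G →L[ℝ] ℝ) (p : G) :
    TangentSpace 𝓘(ℝ, E) p →L[ℝ] ℝ :=
  l ∘L leftTriv p

theorem leftForm_apply (l : GroupLieAlgebra 𝓘(ℝ, E) G →L[ℝ] ℝ) (p : G)
    (u : TangentSpace 𝓘(ℝ, E) p) : leftForm l p u = l (leftTriv p u) := rfl

variable [LieGroup 𝓘(ℝ, E) ∞ G]

/-- Removes the target chart at `p⁻¹ * p`; variable base points `r`, `s` make the substitution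
possible. -/
theorem symmL_continuousLinearMapAt_of_eq_one {r s : G} (hr : r = 1) (hs : s = 1) (y : E) :
    ((trivializationAt E (TangentSpace 𝓘(ℝ, E)) r).symmL ℝ (1 : G)
      ((trivializationAt E (TangentSpace 𝓘(ℝ, E)) r).continuousLinearMapAt ℝ s y : E) : E) = y := by
  subst hr hs
  exact Trivialization.symmL_continuousLinearMapAt _ (FiberBundle.mem_baseSet_trivializationAt' _) _

theorem contMDiffAt_leftForm_comp_symmL (l : GroupLieAlgebra 𝓘(ℝ, E) G →L[ℝ] ℝ) (p : G) :
    ContMDiffAt 𝓘(ℝ, E) 𝓘(ℝ, E →L[ℝ] ℝ) ∞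
      (fun q => leftForm l q ∘L (trivializationAt E (TangentSpace 𝓘(ℝ, E)) p).symmL ℝ q) p := by
  let k : E →L[ℝ] E := (trivializationAt E (TangentSpace 𝓘(ℝ, E)) (p⁻¹ * p)).symmL ℝ (1 : G)
  let l' : E →L[ℝ] ℝ := l
  have h1 : ContMDiffAt 𝓘(ℝ, E) 𝓘(ℝ, E →L[ℝ] ℝ) ∞ (fun _ : G => l' ∘L k) p := contMDiffAt_const
  refine (h1.clm_comp (contMDiffAt_leftTriv_inTangentCoordinates p)).congr_of_eventuallyEq ?_
  refine Filter.Eventually.of_forall fun q => ContinuousLinearMap.ext fun y => ?_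
  refine congrArg l' ?_
  exact (symmL_continuousLinearMapAt_of_eq_one (inv_mul_cancel p) (inv_mul_cancel q) _).symm

theorem contMDiff_leftForm (l : GroupLieAlgebra 𝓘(ℝ, E) G →L[ℝ] ℝ) :
    ContMDiff 𝓘(ℝ, E) (𝓘(ℝ, E).prod 𝓘(ℝ, E →L[ℝ] ℝ)) ∞
      (fun q => TotalSpace.mk' (E →L[ℝ] ℝ)
        (E := fun q : G => TangentSpace 𝓘(ℝ, E) q →L[ℝ] Trivial G ℝ q) q (leftForm l q)) := by
  intro p
  rw [contMDiffAt_hom_bundle]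
  refine ⟨contMDiffAt_id, (contMDiffAt_leftForm_comp_symmL l p).congr_of_eventuallyEq ?_⟩
  refine Filter.Eventually.of_forall fun q => ContinuousLinearMap.ext fun y => ?_
  simp [ContinuousLinearMap.inCoordinates]

theorem mdifferentiableAt_leftForm_apply (l : GroupLieAlgebra 𝓘(ℝ, E) G →L[ℝ] ℝ) {p : G}
    {Y : ∀ q : G, TangentSpace 𝓘(ℝ, E) q} (hY : MDiffAt (T% Y) p) :
    MDiffAt (fun q => leftForm l q (Y q)) p := by
  have h := ((contMDiff_leftForm l).contMDiffAt (x := p)).mdifferentiableAt (by simp)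
  have h2 := MDifferentiableAt.clm_bundle_apply (F₁ := E) (F₂ := ℝ) (E₂ := Trivial G ℝ)
    (b := id) h hY
  exact ((mdifferentiableAt_totalSpace _ _).1 h2).2

/-- The left-invariant bilinear form `∑ l i ⊗ l i`. -/
def sumSqForm {ι : Type*} [Fintype ι] (l : ι → GroupLieAlgebra 𝓘(ℝ, E) G →L[ℝ] ℝ) :
    TensorField02 E G :=
  fun p => ∑ i, (leftForm (l i) p).smulRight (leftForm (l i) p)

omit [LieGroup 𝓘(ℝ, E) ∞ G] in
theorem sumSqForm_apply {ι : Type*} [Fintype ι] (l : ι → GroupLieAlgebra 𝓘(ℝ, E) G →L[ℝ] ℝ)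
    (p : G) (u w : TangentSpace 𝓘(ℝ, E) p) :
    sumSqForm l p u w = ∑ i, leftForm (l i) p u * leftForm (l i) p w := by
  simp [sumSqForm]

theorem isLeftInvariant_sumSqForm {ι : Type*} [Fintype ι]
    (l : ι → GroupLieAlgebra 𝓘(ℝ, E) G →L[ℝ] ℝ) : IsLeftInvariant (sumSqForm l) := by
  intro a p u w
  simp only [sumSqForm_apply, leftForm_apply, leftTriv_mfderiv_mul_left]

-- In the trivialization at `p` the form is a sum of tensor squares of the local covectors, and the
-- tensor product is a continuous bilinear map.
set_option synthInstance.maxHeartbeats 200000 in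
theorem contMDiff_sumSqForm {ι : Type*} [Fintype ι]
    (l : ι → GroupLieAlgebra 𝓘(ℝ, E) G →L[ℝ] ℝ) :
    ContMDiff 𝓘(ℝ, E) (𝓘(ℝ, E).prod 𝓘(ℝ, E →L[ℝ] E →L[ℝ] ℝ)) ∞
      (fun p => TotalSpace.mk' (E →L[ℝ] E →L[ℝ] ℝ)
        (E := fun p : G => TangentSpace 𝓘(ℝ, E) p →L[ℝ] TangentSpace 𝓘(ℝ, E) p →L[ℝ] ℝ) p
          (sumSqForm l p)) := by
  intro p
  rw [contMDiffAt_hom_bundle]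
  refine ⟨contMDiffAt_id, ?_⟩
  have h : ContMDiffAt 𝓘(ℝ, E) 𝓘(ℝ, E →L[ℝ] E →L[ℝ] ℝ) ∞ (fun q : G => ∑ i,
      ContinuousLinearMap.smulRightL ℝ E (E →L[ℝ] ℝ)
        (leftForm (l i) q ∘L (trivializationAt E (TangentSpace 𝓘(ℝ, E)) p).symmL ℝ q)
        (leftForm (l i) q ∘L (trivializationAt E (TangentSpace 𝓘(ℝ, E)) p).symmL ℝ q)) p := by
    refine ContMDiffAt.sum fun i _ => ?_
    have hi := contMDiffAt_leftForm_comp_symmL (l i) p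
    exact (contMDiffAt_const.clm_apply hi).clm_apply hi
  refine h.congr_of_eventuallyEq ?_
  have hb := (trivializationAt E (TangentSpace 𝓘(ℝ, E)) p).open_baseSet.mem_nhds
    (FiberBundle.mem_baseSet_trivializationAt' p)
  filter_upwards [hb] with q hq
  ext y z
  rw [inCoordinates_apply_eq₂ hq hq (by simp)]
  simp
  have e := Trivialization.symmL_apply (R := ℝ) (b := q)
    (trivializationAt E (TangentSpace 𝓘(ℝ, E)) p)
  refine Eq.trans ?_ (sumSqForm_apply l q
    ((trivializationAt E (TangentSpace 𝓘(ℝ, E)) p).symmL ℝ q y)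
    ((trivializationAt E (TangentSpace 𝓘(ℝ, E)) p).symmL ℝ q z))
  rw [e hq, e hq]

end Coframe

/-! ### The left-invariant metric with a prescribed orthonormal basis. -/

section Metric

variable {E : Type*} [NormedAddCommGroup E] [NormedSpace ℝ E] [FiniteDimensional ℝ E]
  {G : Type*} [TopologicalSpace G] [ChartedSpace E G] [Group G]
  {ι : Type*} [Fintype ι]

/-- The coordinate functions of a basis of the Lie algebra, as continuous linear forms. -/
def coordForm (v : Basis ι ℝ (GroupLieAlgebra 𝓘(ℝ, E) G)) (i : ι) :
    GroupLieAlgebra 𝓘(ℝ, E) G →L[ℝ] ℝ :=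
  (LinearMap.toContinuousLinearMap (v.coord i : E →ₗ[ℝ] ℝ) : E →L[ℝ] ℝ)

omit [Fintype ι] in
theorem coordForm_apply (v : Basis ι ℝ (GroupLieAlgebra 𝓘(ℝ, E) G)) (i : ι)
    (x : GroupLieAlgebra 𝓘(ℝ, E) G) : coordForm v i x = v.repr x i := rfl

variable [LieGroup 𝓘(ℝ, E) ∞ G]

theorem sum_leftForm_smul (v : Basis ι ℝ (GroupLieAlgebra 𝓘(ℝ, E) G)) (p : G)
    (u : TangentSpace 𝓘(ℝ, E) p) :
    ∑ i, leftForm (coordForm v i) p u • mulInvariantVectorField (v i) p = u := by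
  have h := congrArg (leftTrivSymm p) (v.sum_repr (leftTriv p u))
  rw [leftTrivSymm_leftTriv, map_sum] at h
  simp only [map_smul] at h
  exact h

omit [FiniteDimensional ℝ E] in
theorem leftForm_mulInvariantVectorField (l : GroupLieAlgebra 𝓘(ℝ, E) G →L[ℝ] ℝ) (p : G)
    (x : GroupLieAlgebra 𝓘(ℝ, E) G) : leftForm l p (mulInvariantVectorField x p) = l x :=
  congrArg l (leftTriv_leftTrivSymm p x)

theorem sumSqForm_pos (v : Basis ι ℝ (GroupLieAlgebra 𝓘(ℝ, E) G)) (p : G)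
    (u : TangentSpace 𝓘(ℝ, E) p) (hu : u ≠ 0) : 0 < sumSqForm (coordForm v) p u u := by
  rw [sumSqForm_apply]
  refine lt_of_le_of_ne (Finset.sum_nonneg fun i _ => mul_self_nonneg _) fun h => hu ?_
  rw [eq_comm, Finset.sum_eq_zero_iff_of_nonneg fun i _ => mul_self_nonneg _] at h
  rw [← sum_leftForm_smul v p u]
  refine Finset.sum_eq_zero fun i hi => ?_
  rw [mul_self_eq_zero.1 (h i hi), zero_smul]

/-- Each frame coordinate of such a vector is less than `1` in absolute value, so the set lies in
the continuous linear image of the unit ball of `ι → ℝ`. -/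
theorem isVonNBounded_sumSqForm (v : Basis ι ℝ (GroupLieAlgebra 𝓘(ℝ, E) G)) (p : G) :
    Bornology.IsVonNBounded ℝ
      {u : TangentSpace 𝓘(ℝ, E) p | sumSqForm (coordForm v) p u u < 1} := by
  let f : (ι → ℝ) →L[ℝ] TangentSpace 𝓘(ℝ, E) p :=
    ∑ i, (ContinuousLinearMap.proj i).smulRight (mulInvariantVectorField (v i) p)
  refine ((NormedSpace.isVonNBounded_ball ℝ (ι → ℝ) 1).image f).subset fun u hu => ?_
  refine ⟨fun i => leftForm (coordForm v i) p u, ?_, ?_⟩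
  · rw [mem_ball_zero_iff, pi_norm_lt_iff one_pos]
    intro i
    rw [Set.mem_ofPred_eq, sumSqForm_apply] at hu
    have h := (Finset.single_le_sum (f := fun i => leftForm (coordForm v i) p u *
      leftForm (coordForm v i) p u) (fun i _ => mul_self_nonneg _) (Finset.mem_univ i)).trans_lt hu
    rw [Real.norm_eq_abs, abs_lt]
    constructor <;> nlinarith
  · simpa [f] using sum_leftForm_smul v p u

/-- The left-invariant metric for which the given basis of the Lie algebra is orthonormal. -/
def orthonormalMetric (v : Basis ι ℝ (GroupLieAlgebra 𝓘(ℝ, E) G)) : SmoothMetric E G where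
  inner := sumSqForm (coordForm v)
  symm p u w := by simp only [sumSqForm_apply, mul_comm]
  pos := sumSqForm_pos v
  isVonNBounded := isVonNBounded_sumSqForm v
  contMDiff := contMDiff_sumSqForm (coordForm v)

end Metric

/-! ### Existence of the Levi-Civita connection. -/

section Connection

variable {E : Type*} [NormedAddCommGroup E] [NormedSpace ℝ E] [FiniteDimensional ℝ E]
  {G : Type*} [TopologicalSpace G] [ChartedSpace E G] [Group G]
  {ι : Type*} [Fintype ι]

/-- The structure constants of the Lie algebra in the basis `v`. -/
def structureConst (v : Basis ι ℝ (GroupLieAlgebra 𝓘(ℝ, E) G)) (i j k : ι) : ℝ :=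
  v.repr ⁅v i, v j⁆ k

/-- The Christoffel symbols that the Koszul formula associates to the structure constants `c`. -/
def koszul (c : ι → ι → ι → ℝ) (i j k : ι) : ℝ := (c i j k - c j k i + c k i j) / 2

variable [LieGroup 𝓘(ℝ, E) ∞ G]

omit [FiniteDimensional ℝ E] [Fintype ι] [LieGroup 𝓘(ℝ, E) ∞ G] in
theorem structureConst_swap (v : Basis ι ℝ (GroupLieAlgebra 𝓘(ℝ, E) G)) (i j k : ι) :
    structureConst v j i k = -structureConst v i j k := by
  have h : ⁅v j, v i⁆ = -⁅v i, v j⁆ := mlieBracket_swap_apply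
  rw [structureConst, h, map_neg]; rfl

theorem mlieBracket_frame (v : Basis ι ℝ (GroupLieAlgebra 𝓘(ℝ, E) G)) (i j : ι) (p : G) :
    mlieBracket 𝓘(ℝ, E) (mulInvariantVectorField (v i)) (mulInvariantVectorField (v j)) p =
      ∑ k, structureConst v i j k • mulInvariantVectorField (v k) p := by
  have : CompleteSpace E := FiniteDimensional.complete ℝ E
  have : LieGroup 𝓘(ℝ, E) (minSmoothness ℝ 3) G := by
    rw [minSmoothness_of_isRCLikeNormedField]; infer_instance
  rw [← mulInvariantVector_mlieBracket, mulInvariantVectorField_eq_leftTrivSymm,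
    ← GroupLieAlgebra.bracket_def, ← v.sum_repr ⁅v i, v j⁆, map_sum]
  simp only [map_smul]
  rfl

omit [FiniteDimensional ℝ E] in
theorem mdifferentiableAt_frame (x : GroupLieAlgebra 𝓘(ℝ, E) G) (p : G) :
    MDiffAt (T% (mulInvariantVectorField x : ∀ q : G, TangentSpace 𝓘(ℝ, E) q)) p := by
  have : LieGroup 𝓘(ℝ, E) (minSmoothness ℝ 3) G := by
    rw [minSmoothness_of_isRCLikeNormedField]; infer_instance
  exact mdifferentiableAt_mulInvariantVectorField x

/-- The covariant derivative with Christoffel symbols `Γ` in the left-invariant frame of `v`. -/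
def frameCov (v : Basis ι ℝ (GroupLieAlgebra 𝓘(ℝ, E) G)) (Γ : ι → ι → ι → ℝ)
    (Y : ∀ q : G, TangentSpace 𝓘(ℝ, E) q) (p : G) :
    TangentSpace 𝓘(ℝ, E) p →L[ℝ] TangentSpace 𝓘(ℝ, E) p :=
  ∑ k, (mvfderiv 𝓘(ℝ, E) (fun q => leftForm (coordForm v k) q (Y q)) p +
    ∑ i, ∑ j, (Γ i j k * leftForm (coordForm v j) p (Y p)) • leftForm (coordForm v i) p).smulRight
      (mulInvariantVectorField (v k) p)

omit [LieGroup 𝓘(ℝ, E) ∞ G] in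
theorem frameCov_apply (v : Basis ι ℝ (GroupLieAlgebra 𝓘(ℝ, E) G)) (Γ : ι → ι → ι → ℝ)
    (Y : ∀ q : G, TangentSpace 𝓘(ℝ, E) q) (p : G) (u : TangentSpace 𝓘(ℝ, E) p) :
    frameCov v Γ Y p u = ∑ k, (mvfderiv 𝓘(ℝ, E) (fun q => leftForm (coordForm v k) q (Y q)) p u +
      ∑ i, ∑ j, Γ i j k * leftForm (coordForm v j) p (Y p) * leftForm (coordForm v i) p u) •
        mulInvariantVectorField (v k) p := by
  simp [frameCov]

theorem leftForm_frameCov (v : Basis ι ℝ (GroupLieAlgebra 𝓘(ℝ, E) G)) (Γ : ι → ι → ι → ℝ)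
    (Y : ∀ q : G, TangentSpace 𝓘(ℝ, E) q) (p : G) (u : TangentSpace 𝓘(ℝ, E) p) (k : ι) :
    leftForm (coordForm v k) p (frameCov v Γ Y p u) =
      mvfderiv 𝓘(ℝ, E) (fun q => leftForm (coordForm v k) q (Y q)) p u +
      ∑ i, ∑ j, Γ i j k * leftForm (coordForm v j) p (Y p) * leftForm (coordForm v i) p u := by
  classical
  rw [frameCov_apply, map_sum]
  simp only [map_smul, leftForm_mulInvariantVectorField, coordForm_apply, Basis.repr_self,
    Finsupp.single_apply, smul_eq_mul, mul_ite, mul_one, mul_zero, Finset.sum_ite_eq',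
    Finset.mem_univ, if_true]

theorem ext_leftForm (v : Basis ι ℝ (GroupLieAlgebra 𝓘(ℝ, E) G)) {p : G}
    {u w : TangentSpace 𝓘(ℝ, E) p}
    (h : ∀ k, leftForm (coordForm v k) p u = leftForm (coordForm v k) p w) : u = w := by
  rw [← sum_leftForm_smul v p u, ← sum_leftForm_smul v p w]
  simp only [h]

/-- The connection whose Christoffel symbols in the left-invariant frame of `v` are `Γ`. -/
def frameConnection (v : Basis ι ℝ (GroupLieAlgebra 𝓘(ℝ, E) G)) (Γ : ι → ι → ι → ℝ) :
    AffineConnection E G where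
  toFun := frameCov v Γ
  isCovariantDerivativeOnUniv := by
    constructor
    · intro Y Z p hY hZ _
      refine ContinuousLinearMap.ext fun u => ext_leftForm v fun k => ?_
      have h := mvfderiv_fun_add (mdifferentiableAt_leftForm_apply (coordForm v k) hY)
        (mdifferentiableAt_leftForm_apply (coordForm v k) hZ)
      simp only [add_apply, map_add, leftForm_frameCov, Pi.add_apply, h, mul_add, add_mul,
        Finset.sum_add_distrib]
      ring
    · intro Y f p hY hf _
      refine ContinuousLinearMap.ext fun u => ext_leftForm v fun k => ?_
      have h := mvfderiv_fun_mul hf (mdifferentiableAt_leftForm_apply (coordForm v k) hY)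
      simp only [add_apply, map_add, leftForm_frameCov, Pi.smul_apply', h, map_smul, smul_apply,
        ContinuousLinearMap.smulRight_apply, smul_eq_mul, mul_add, Finset.mul_sum,
        mul_left_comm _ (f p), mul_assoc]
      ring

theorem frameCov_frame (v : Basis ι ℝ (GroupLieAlgebra 𝓘(ℝ, E) G)) (Γ : ι → ι → ι → ℝ)
    (i j : ι) (p : G) :
    frameCov v Γ (mulInvariantVectorField (v j)) p (mulInvariantVectorField (v i) p) =
      ∑ k, Γ i j k • mulInvariantVectorField (v k) p := by
  classical
  rw [frameCov_apply]
  refine Finset.sum_congr rfl fun k _ => ?_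
  rw [Finset.sum_comm]
  simp only [leftForm_mulInvariantVectorField, mvfderiv_const, coordForm_apply, Basis.repr_self,
    Finsupp.single_apply, mul_ite, mul_one, mul_zero, Finset.sum_ite_eq,
    Finset.mem_univ, if_true, zero_apply, zero_add]

omit [Group G] [FiniteDimensional ℝ E] [Fintype ι] [LieGroup 𝓘(ℝ, E) ∞ G] in
theorem mdifferentiableAt_fun_sum {f : ι → G → ℝ} {p : G} (s : Finset ι)
    (hf : ∀ i, MDifferentiableAt 𝓘(ℝ, E) 𝓘(ℝ, ℝ) (f i) p) :
    MDifferentiableAt 𝓘(ℝ, E) 𝓘(ℝ, ℝ) (fun q => ∑ i ∈ s, f i q) p := by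
  classical
  induction s using Finset.induction_on with
  | empty => simpa using mdifferentiableAt_const
  | insert i s hi ih =>
    simp only [Finset.sum_insert hi]
    exact (hf i).add ih

omit [Group G] [FiniteDimensional ℝ E] [Fintype ι] [LieGroup 𝓘(ℝ, E) ∞ G] in
theorem mvfderiv_fun_sum {f : ι → G → ℝ} {p : G} (s : Finset ι)
    (hf : ∀ i, MDifferentiableAt 𝓘(ℝ, E) 𝓘(ℝ, ℝ) (f i) p) :
    mvfderiv 𝓘(ℝ, E) (fun q => ∑ i ∈ s, f i q) p = ∑ i ∈ s, mvfderiv 𝓘(ℝ, E) (f i) p := by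
  classical
  induction s using Finset.induction_on with
  | empty => simpa using mvfderiv_const (0 : ℝ)
  | insert i s hi ih =>
    simp only [Finset.sum_insert hi]
    rw [mvfderiv_fun_add (hf i) (mdifferentiableAt_fun_sum s hf), ih]

-- Metric compatibility in coordinates: for Christoffel symbols antisymmetric in the last two
-- indices the zeroth-order terms cancel, leaving the Leibniz rule. Here `y'`, `z'` stand for the
-- derivatives of `y`, `z`.
omit [FiniteDimensional ℝ E] [LieGroup 𝓘(ℝ, E) ∞ G] in
theorem sum_mul_add_sum_mul_of_antisymm {Γ : ι → ι → ι → ℝ} (hΓ : ∀ i j k, Γ i j k = -Γ i k j)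
    (u y z y' z' : ι → ℝ) :
    ∑ k, (y' k + ∑ i, ∑ j, Γ i j k * y j * u i) * z k +
      ∑ k, y k * (z' k + ∑ i, ∑ j, Γ i j k * z j * u i) = ∑ k, (y k * z' k + z k * y' k) := by
  have h : ∑ k, y k * ∑ i, ∑ j, Γ i j k * z j * u i =
      - ∑ k, (∑ i, ∑ j, Γ i j k * y j * u i) * z k := by
    simp only [Finset.mul_sum, Finset.sum_mul, ← Finset.sum_neg_distrib]
    rw [Finset.sum_comm]
    conv_rhs => rw [Finset.sum_comm]
    refine Finset.sum_congr rfl fun i _ => ?_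
    rw [Finset.sum_comm]
    refine Finset.sum_congr rfl fun j _ => Finset.sum_congr rfl fun k _ => ?_
    rw [hΓ]; ring
  simp only [add_mul, mul_add, Finset.sum_add_distrib, h, mul_comm (z _) (y' _)]
  ring

/-- Torsion is a tensor, so it is tested on the frame only. Compatibility concerns arbitrary
differentiable fields and is checked in coordinates. -/
theorem isLeviCivita_frameConnection [CompleteSpace E]
    (v : Basis ι ℝ (GroupLieAlgebra 𝓘(ℝ, E) G)) :
    IsLeviCivita (orthonormalMetric v) (frameConnection v (koszul (structureConst v))) := by
  constructor
  · have key : ∀ (p : G) (i j : ι), (frameConnection v (koszul (structureConst v))).torsion p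
        (mulInvariantVectorField (v i) p) (mulInvariantVectorField (v j) p) = 0 := by
      intro p i j
      rw [CovariantDerivative.torsion_apply _ (mdifferentiableAt_frame _ p)
        (mdifferentiableAt_frame _ p), mlieBracket_frame]
      change frameCov v _ _ p _ - frameCov v _ _ p _ - _ = _
      rw [frameCov_frame, frameCov_frame, ← Finset.sum_sub_distrib, ← Finset.sum_sub_distrib]
      refine Finset.sum_eq_zero fun k _ => ?_
      rw [← sub_smul, ← sub_smul, koszul, koszul, structureConst_swap v i j k,
        structureConst_swap v i k j, structureConst_swap v j k i]
      convert! zero_smul ℝ _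
      ring
    funext p
    refine ContinuousLinearMap.ext fun u => ContinuousLinearMap.ext fun w => ?_
    change _ = (0 : TangentSpace 𝓘(ℝ, E) p)
    rw [← sum_leftForm_smul v p u, ← sum_leftForm_smul v p w]
    simp only [map_sum, map_smul, sum_apply, smul_apply, key, smul_zero, Finset.sum_const_zero]
  · intro p u Y Z hY hZ
    have hY' k := mdifferentiableAt_leftForm_apply (coordForm v k) hY
    have hZ' k := mdifferentiableAt_leftForm_apply (coordForm v k) hZ
    change mvfderiv 𝓘(ℝ, E) (fun q => sumSqForm (coordForm v) q (Y q) (Z q)) p u =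
      sumSqForm (coordForm v) p (frameCov v _ Y p u) (Z p) +
      sumSqForm (coordForm v) p (Y p) (frameCov v _ Z p u)
    simp only [sumSqForm_apply, leftForm_frameCov]
    have h k := mvfderiv_fun_mul (hY' k) (hZ' k)
    rw [mvfderiv_fun_sum (f := fun k q => leftForm (coordForm v k) q (Y q) *
      leftForm (coordForm v k) q (Z q)) Finset.univ fun k => (hY' k).mul (hZ' k)]
    simp only [h, sum_apply, add_apply, smul_apply, smul_eq_mul]
    set Γ := koszul (structureConst v)
    have hΓ : ∀ i j k, Γ i j k = - Γ i k j := by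
      intro i j k
      simp only [Γ, koszul]
      rw [structureConst_swap v i j k,
        structureConst_swap v i k j, structureConst_swap v j k i]
      ring
    exact (sum_mul_add_sum_mul_of_antisymm hΓ _ _ _ _ _).symm

end Connection

/-! ### Curvature and Ricci form of a bilinear map on a vector space. -/

section Algebra

variable {L : Type*} [AddCommGroup L] [Module ℝ L] {ι : Type*} [Fintype ι]

/-- The bilinear map with coefficients `Γ` in the basis `v`. -/
def bilinOfCoeff (v : Basis ι ℝ L) (Γ : ι → ι → ι → ℝ) : L →ₗ[ℝ] L →ₗ[ℝ] L :=
  v.constr ℝ fun i => v.constr ℝ fun j => ∑ k, Γ i j k • v k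

theorem bilinOfCoeff_basis (v : Basis ι ℝ L) (Γ : ι → ι → ι → ℝ) (i j : ι) :
    bilinOfCoeff v Γ (v i) (v j) = ∑ k, Γ i j k • v k := by
  rw [bilinOfCoeff, Basis.constr_basis, Basis.constr_basis]

/-- The curvature `∇_x ∇_y z - ∇_y ∇_x z - ∇_{[x,y]} z` of a bilinear map `D = ∇` for the
bracket `B`. -/
def algCurvature (D B : L →ₗ[ℝ] L →ₗ[ℝ] L) (x y z : L) : L :=
  D x (D y z) - D y (D x z) - D (B x y) z

/-- The trace of `x ↦ R(x,y)z`. -/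
def algRicci (v : Basis ι ℝ L) (D B : L →ₗ[ℝ] L →ₗ[ℝ] L) : L →ₗ[ℝ] L →ₗ[ℝ] ℝ :=
  LinearMap.mk₂ ℝ (fun y z => ∑ a, v.repr (algCurvature D B (v a) y z) a)
    (fun y y' z => by
      simp only [algCurvature, map_add, LinearMap.add_apply, map_sub, Finsupp.coe_sub,
        Finsupp.coe_add, Pi.sub_apply, Pi.add_apply, ← Finset.sum_add_distrib]
      exact Finset.sum_congr rfl fun a _ => by ring)
    (fun r y z => by
      simp only [algCurvature, map_smul, LinearMap.smul_apply, map_sub, Finsupp.coe_sub,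
        Finsupp.coe_smul, Pi.sub_apply, Pi.smul_apply, smul_eq_mul, mul_sub, Finset.mul_sum,
        Finset.sum_sub_distrib])
    (fun y z z' => by
      simp only [algCurvature, map_add, map_sub, Finsupp.coe_sub,
        Finsupp.coe_add, Pi.sub_apply, Pi.add_apply, ← Finset.sum_add_distrib]
      exact Finset.sum_congr rfl fun a _ => by ring)
    (fun r y z => by
      simp only [algCurvature, map_smul, map_sub, Finsupp.coe_sub,
        Finsupp.coe_smul, Pi.sub_apply, Pi.smul_apply, smul_eq_mul, mul_sub, Finset.mul_sum,
        Finset.sum_sub_distrib])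

theorem algRicci_apply (v : Basis ι ℝ L) (D B : L →ₗ[ℝ] L →ₗ[ℝ] L) (y z : L) :
    algRicci v D B y z = ∑ a, v.repr (algCurvature D B (v a) y z) a := rfl

/-- Makes the independence of the basis visible, so that the trace can later be moved to the basis
used in `ricci`. -/
theorem algRicci_eq_trace (v : Basis ι ℝ L) (D B : L →ₗ[ℝ] L →ₗ[ℝ] L) (y z : L) :
    algRicci v D B y z =
      LinearMap.trace ℝ L (D.flip (D y z) - D y ∘ₗ D.flip z - D.flip z ∘ₗ B.flip y) := by
  classical
  rw [LinearMap.trace_eq_matrix_trace ℝ v]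
  simp [algRicci_apply, Matrix.trace, LinearMap.toMatrix_apply, algCurvature]

theorem trace_eq_sum_coord (b : Basis ι ℝ L) (f : L →ₗ[ℝ] L) :
    LinearMap.trace ℝ L f = ∑ i, b.coord i (f (b i)) := by
  classical
  rw [LinearMap.trace_eq_matrix_trace ℝ b]
  simp [Matrix.trace, LinearMap.toMatrix_apply]

theorem algRicci_bilinOfCoeff_basis (v : Basis ι ℝ L) (Γ c : ι → ι → ι → ℝ) (i j : ι) :
    algRicci v (bilinOfCoeff v Γ) (bilinOfCoeff v c) (v i) (v j) =
      ∑ a, ∑ k, (Γ i j k * Γ a k a - Γ a j k * Γ i k a - c a i k * Γ k j a) := by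
  classical
  rw [algRicci_apply]
  refine Finset.sum_congr rfl fun a _ => ?_
  simp only [algCurvature, bilinOfCoeff_basis, map_sum, map_smul, LinearMap.sum_apply,
    LinearMap.smul_apply, map_sub, Finsupp.coe_sub, Pi.sub_apply, Finsupp.coe_finsetSum,
    Finset.sum_apply, Finsupp.coe_smul, Pi.smul_apply, Basis.repr_self, Finsupp.single_apply,
    smul_eq_mul, mul_ite, mul_one, mul_zero, Finset.sum_ite_eq', Finset.mem_univ, if_true,
    Finset.sum_sub_distrib]

-- The Koszul argument: antisymmetry (metric) and the torsion identity determine `w`, by an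
-- alternating sum of the torsion identity over cyclic permutations.
omit [Fintype ι] in
theorem eq_koszul {w c : ι → ι → ι → ℝ} (h : ∀ i j k, w i j k + w i k j = 0)
    (h' : ∀ i j k, w i j k - w j i k = c i j k) (i j k : ι) : w i j k = koszul c i j k := by
  rw [koszul, ← h' i j k, ← h' j k i, ← h' k i j]
  linear_combination (h i k j + h j k i - h k i j) / 2

end Algebra

/-! ### Uniqueness of the Levi-Civita connection on left-invariant fields. -/

section LeviCivita

variable {E : Type*} [NormedAddCommGroup E] [NormedSpace ℝ E] [FiniteDimensional ℝ E]
  {G : Type*} [TopologicalSpace G] [ChartedSpace E G] [Group G] [LieGroup 𝓘(ℝ, E) ∞ G]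
  {ι : Type*} [Fintype ι]

omit [FiniteDimensional ℝ E] [LieGroup 𝓘(ℝ, E) ∞ G] in
theorem IsLeftInvariant.eq_leftTriv {S : TensorField02 E G} (hS : IsLeftInvariant S) (p : G)
    (u w : TangentSpace 𝓘(ℝ, E) p) : S p u w = S 1 (leftTriv p u) (leftTriv p w) := by
  have e : ∀ (r : G) (x y : E), r = 1 →
      ((S r : E →L[ℝ] E →L[ℝ] ℝ) x y = (S 1 : E →L[ℝ] E →L[ℝ] ℝ) x y) := by
    rintro r x y rfl; rfl
  exact (hS p⁻¹ p u w).symm.trans (e _ _ _ (inv_mul_cancel p))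

omit [FiniteDimensional ℝ E] in
theorem inner_frame {g : SmoothMetric E G} (hg : IsLeftInvariant g.inner)
    (p : G) (x y : GroupLieAlgebra 𝓘(ℝ, E) G) :
    g.inner p (mulInvariantVectorField x p) (mulInvariantVectorField y p) = g.inner 1 x y := by
  rw [hg.eq_leftTriv]
  exact congrArg₂ (fun a b => g.inner 1 a b) (leftTriv_leftTrivSymm p x) (leftTriv_leftTrivSymm p y)

/-- Inner products of left-invariant fields are constant, so compatibility becomes antisymmetry of
the coefficients and `eq_koszul` applies. -/
theorem IsLeviCivita.apply_frame [CompleteSpace E] [DecidableEq ι] {g : SmoothMetric E G}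
    (hg : IsLeftInvariant g.inner)
    {nabla : AffineConnection E G} (h : IsLeviCivita g nabla)
    {v : Basis ι ℝ (GroupLieAlgebra 𝓘(ℝ, E) G)}
    (hv : ∀ i j, g.inner 1 (v i) (v j) = if i = j then 1 else 0) (i j : ι) (p : G) :
    nabla (mulInvariantVectorField (v j)) p (mulInvariantVectorField (v i) p) =
      ∑ k, koszul (structureConst v) i j k • mulInvariantVectorField (v k) p := by
  have hc : ∀ (u : TangentSpace 𝓘(ℝ, E) p) k,
      g.inner p u (mulInvariantVectorField (v k) p) = leftForm (coordForm v k) p u := by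
    intro u k
    conv_lhs => rw [← sum_leftForm_smul v p u]
    simp only [map_sum, map_smul, sum_apply, smul_apply, inner_frame hg, hv, smul_eq_mul, mul_ite,
      mul_one, mul_zero, Finset.sum_ite_eq', Finset.mem_univ, if_true]
  refine ext_leftForm v fun l => ?_
  have key := eq_koszul (w := fun i j k => g.inner p
    (nabla (mulInvariantVectorField (v j)) p (mulInvariantVectorField (v i) p))
    (mulInvariantVectorField (v k) p)) (c := structureConst v) ?_ ?_ i j l
  · rw [← hc, key, map_sum]
    simp only [map_smul, leftForm_mulInvariantVectorField, coordForm_apply, Basis.repr_self,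
      Finsupp.single_apply, smul_eq_mul, mul_ite, mul_one, mul_zero, Finset.sum_ite_eq',
      Finset.mem_univ, if_true]
  · intro i j k
    have h2 := h.2 p (mulInvariantVectorField (v i) p) _ _ (mdifferentiableAt_frame (v j) p)
      (mdifferentiableAt_frame (v k) p)
    simp only [inner_frame hg, mvfderiv_const, zero_apply] at h2
    rw [h2, g.symm p (mulInvariantVectorField (v j) p)]
  · intro i j k
    have h1 := CovariantDerivative.torsion_apply nabla (mdifferentiableAt_frame (v i) p)
      (mdifferentiableAt_frame (v j) p)
    rw [h.1, mlieBracket_frame] at h1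
    have h3 := congrArg (leftForm (coordForm v k) p) h1.symm
    rw [map_sub, map_sub, ← hc, ← hc, map_sum] at h3
    simp only [map_smul, leftForm_mulInvariantVectorField, coordForm_apply, Basis.repr_self,
      Finsupp.single_apply, smul_eq_mul, mul_ite, mul_one, mul_zero, Finset.sum_ite_eq',
      Finset.mem_univ, if_true] at h3
    refine sub_eq_zero.1 (h3.trans ?_)
    exact map_zero _

end LeviCivita

/-! ### Reduction of curvature and Ricci tensor to the Lie algebra. -/

section Curvature

variable {E : Type*} [NormedAddCommGroup E] [NormedSpace ℝ E] [FiniteDimensional ℝ E]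
  {G : Type*} [TopologicalSpace G] [ChartedSpace E G] [Group G] [LieGroup 𝓘(ℝ, E) ∞ G]
  {ι : Type*} [Fintype ι]

-- Both sides are bilinear in `x` and `y`. In particular the derivative of a left-invariant field is
-- again left-invariant, so second derivatives can be taken the same way.
omit [FiniteDimensional ℝ E] in
theorem apply_mulInvariantVectorField {nabla : AffineConnection E G}
    {v : Basis ι ℝ (GroupLieAlgebra 𝓘(ℝ, E) G)} {Γ : ι → ι → ι → ℝ}
    (h : ∀ i j p, nabla (mulInvariantVectorField (v j)) p (mulInvariantVectorField (v i) p) =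
      ∑ k, Γ i j k • mulInvariantVectorField (v k) p)
    (x y : GroupLieAlgebra 𝓘(ℝ, E) G) (p : G) :
    nabla (mulInvariantVectorField y) p (mulInvariantVectorField x p) =
      mulInvariantVectorField (bilinOfCoeff v Γ x y) p := by
  let f : GroupLieAlgebra 𝓘(ℝ, E) G →ₗ[ℝ] TangentSpace 𝓘(ℝ, E) p →L[ℝ] TangentSpace 𝓘(ℝ, E) p :=
    { toFun := fun y => nabla (mulInvariantVectorField y) p
      map_add' := fun y z => by
        rw [mulInvariantVectorField_add]
        exact nabla.isCovariantDerivativeOnUniv.add (mdifferentiableAt_frame y p)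
          (mdifferentiableAt_frame z p)
      map_smul' := fun r y => by
        rw [mulInvariantVectorField_smul]
        exact nabla.isCovariantDerivativeOnUniv.smul_const r (mdifferentiableAt_frame y p) }
  let A : GroupLieAlgebra 𝓘(ℝ, E) G →ₗ[ℝ] GroupLieAlgebra 𝓘(ℝ, E) G →ₗ[ℝ]
      TangentSpace 𝓘(ℝ, E) p :=
    LinearMap.mk₂ ℝ (fun x y => f y (leftTrivSymm p x)) (by intros; simp) (by intros; simp)
      (by intros; simp) (by intros; simp)
  have hA : A = (bilinOfCoeff v Γ).compr₂ (leftTrivSymm p).toLinearMap := by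
    refine v.ext fun i => v.ext fun j => ?_
    refine (h i j p).trans ?_
    simp [bilinOfCoeff_basis]
    rfl
  exact congrArg (fun B => B x y) hA

theorem mlieBracket_mulInvariantVectorField (v : Basis ι ℝ (GroupLieAlgebra 𝓘(ℝ, E) G))
    (x y : GroupLieAlgebra 𝓘(ℝ, E) G) (p : G) :
    mlieBracket 𝓘(ℝ, E) (mulInvariantVectorField x) (mulInvariantVectorField y) p =
      mulInvariantVectorField (bilinOfCoeff v (structureConst v) x y) p := by
  let A : GroupLieAlgebra 𝓘(ℝ, E) G →ₗ[ℝ] GroupLieAlgebra 𝓘(ℝ, E) G →ₗ[ℝ]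
      TangentSpace 𝓘(ℝ, E) p :=
    LinearMap.mk₂ ℝ (fun x y =>
      mlieBracket 𝓘(ℝ, E) (mulInvariantVectorField x) (mulInvariantVectorField y) p)
      (fun x x' y => by
        rw [mulInvariantVectorField_add]
        exact mlieBracket_add_left (mdifferentiableAt_frame x p) (mdifferentiableAt_frame x' p))
      (fun r x y => by
        rw [mulInvariantVectorField_smul]
        exact mlieBracket_const_smul_left (mdifferentiableAt_frame x p))
      (fun x y y' => by
        rw [mulInvariantVectorField_add]
        exact mlieBracket_add_right (mdifferentiableAt_frame y p) (mdifferentiableAt_frame y' p))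
      (fun r x y => by
        rw [mulInvariantVectorField_smul]
        exact mlieBracket_const_smul_right (mdifferentiableAt_frame y p))
  have hA : A = (bilinOfCoeff v (structureConst v)).compr₂ (leftTrivSymm p).toLinearMap := by
    refine v.ext fun i => v.ext fun j => ?_
    refine (mlieBracket_frame v i j p).trans ?_
    simp [bilinOfCoeff_basis]
    rfl
  exact congrArg (fun B => B x y) hA

theorem curvature_mulInvariantVectorField {nabla : AffineConnection E G}
    {v : Basis ι ℝ (GroupLieAlgebra 𝓘(ℝ, E) G)} {Γ : ι → ι → ι → ℝ}
    (h : ∀ i j p, nabla (mulInvariantVectorField (v j)) p (mulInvariantVectorField (v i) p) =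
      ∑ k, Γ i j k • mulInvariantVectorField (v k) p)
    (x y z : GroupLieAlgebra 𝓘(ℝ, E) G) (p : G) :
    curvature nabla (mulInvariantVectorField x) (mulInvariantVectorField y)
        (mulInvariantVectorField z) p =
      leftTrivSymm p
        (algCurvature (bilinOfCoeff v Γ) (bilinOfCoeff v (structureConst v)) x y z) := by
  have h' := apply_mulInvariantVectorField h
  have e y z : (fun q => nabla (mulInvariantVectorField z) q (mulInvariantVectorField y q)) =
      mulInvariantVectorField (bilinOfCoeff v Γ y z) := funext fun q => h' y z q
  rw [curvature, e, e, h', h', mlieBracket_mulInvariantVectorField v, h', algCurvature,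
    map_sub, map_sub]
  rfl

theorem ricci_eq_algRicci {nabla : AffineConnection E G}
    {v : Basis ι ℝ (GroupLieAlgebra 𝓘(ℝ, E) G)} {Γ : ι → ι → ι → ℝ}
    (h : ∀ i j p, nabla (mulInvariantVectorField (v j)) p (mulInvariantVectorField (v i) p) =
      ∑ k, Γ i j k • mulInvariantVectorField (v k) p) (p : G) (u w : TangentSpace 𝓘(ℝ, E) p) :
    ricci nabla p u w = algRicci v (bilinOfCoeff v Γ) (bilinOfCoeff v (structureConst v))
      (leftTriv p u) (leftTriv p w) := by
  rw [algRicci_eq_trace, ← LinearMap.trace_conj' _ (leftTrivEquiv p).symm]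
  refine Eq.trans ?_ (trace_eq_sum_coord (L := TangentSpace 𝓘(ℝ, E) p) (finBasis ℝ E) _).symm
  refine Finset.sum_congr rfl fun i _ => ?_
  simp only [leftExtend_eq, curvature_mulInvariantVectorField h]
  rfl

end Curvature

/-! ### The Ricci tensor for the bracket `[v₁, v₂] = α v₅`. -/

section HeisenbergRicci

/-- The structure constants of the bracket `[v₁, v₂] = α v₅` (indices start at `0`). -/
def heisenbergCoeff (α : ℝ) (i j k : Fin 5) : ℝ :=
  if k = 4 then if i = 0 ∧ j = 1 then α else if i = 1 ∧ j = 0 then -α else 0 else 0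

/-- Geometrically, the plane `v₁, v₂` has sectional curvature `-3α²/4` and the planes `v₁, v₅` and
`v₂, v₅` have `α²/4`; the remaining coordinate planes are flat. -/
theorem algRicci_heisenberg {L : Type*} [AddCommGroup L] [Module ℝ L] (v : Basis (Fin 5) ℝ L)
    (α : ℝ) (i j : Fin 5) :
    algRicci v (bilinOfCoeff v (koszul (heisenbergCoeff α))) (bilinOfCoeff v (heisenbergCoeff α))
      (v i) (v j) = Matrix.diagonal ![-(α ^ 2 / 2), -(α ^ 2 / 2), 0, 0, α ^ 2 / 2] i j := by
  rw [algRicci_bilinOfCoeff_basis]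
  fin_cases i <;> fin_cases j <;>
    simp [Fin.sum_univ_five, koszul, heisenbergCoeff, Matrix.diagonal] <;> ring

variable {E : Type*} [NormedAddCommGroup E] [NormedSpace ℝ E]
  {G : Type*} [TopologicalSpace G] [ChartedSpace E G] [Group G]

theorem HasHeisenbergBrackets.structureConst_eq {α : ℝ}
    {v : Basis (Fin 5) ℝ (GroupLieAlgebra 𝓘(ℝ, E) G)} (h : HasHeisenbergBrackets α v) :
    structureConst v = heisenbergCoeff α := by
  funext i j k
  rw [structureConst, h i j, heisenbergCoeff]
  split_ifs <;> simp_all [eq_comm]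

theorem IsLeviCivita.ricci_eq_of_heisenberg [FiniteDimensional ℝ E] [CompleteSpace E]
    [LieGroup 𝓘(ℝ, E) ∞ G] {g : SmoothMetric E G} (hg : IsLeftInvariant g.inner)
    {nabla : AffineConnection E G} (h : IsLeviCivita g nabla) {α : ℝ}
    {v : Basis (Fin 5) ℝ (GroupLieAlgebra 𝓘(ℝ, E) G)}
    (hv : ∀ i j, g.inner 1 (v i) (v j) = if i = j then 1 else 0)
    (hb : HasHeisenbergBrackets α v) (p : G) (u w : TangentSpace 𝓘(ℝ, E) p) :
    ricci nabla p u w =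
      algRicci v (bilinOfCoeff v (koszul (heisenbergCoeff α))) (bilinOfCoeff v (heisenbergCoeff α))
        (leftTriv p u) (leftTriv p w) := by
  rw [ricci_eq_algRicci (h.apply_frame hg hv), hb.structureConst_eq]

end HeisenbergRicci

/-! ### Orthonormal bases in normal form. -/

section GramSchmidt

variable {V : Type*} [NormedAddCommGroup V] [InnerProductSpace ℝ V]

/-- The multiplication table `B (v₁, v₂) = α v₅ = -B (v₂, v₁)` (indices start at `0`). -/
def IsHeisenbergTable (B : V →ₗ[ℝ] V →ₗ[ℝ] V) (α : ℝ) (v : Basis (Fin 5) ℝ V) : Prop :=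
  ∀ i j : Fin 5, B (v i) (v j) =
    if i = 0 ∧ j = 1 then α • v 4 else if i = 1 ∧ j = 0 then -(α • v 4) else 0

theorem IsHeisenbergTable.apply {B : V →ₗ[ℝ] V →ₗ[ℝ] V} {α : ℝ} {e : Basis (Fin 5) ℝ V}
    (h : IsHeisenbergTable B α e) (x y : V) :
    B x y = (α * (e.repr x 0 * e.repr y 1 - e.repr x 1 * e.repr y 0)) • e 4 := by
  conv_lhs => rw [← e.sum_repr x, ← e.sum_repr y]
  simp only [Fin.sum_univ_five, map_add, map_smul, LinearMap.add_apply, LinearMap.smul_apply, h _ _]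
  simp
  module

theorem IsHeisenbergTable.swap {B : V →ₗ[ℝ] V →ₗ[ℝ] V} {α : ℝ} {v : Basis (Fin 5) ℝ V}
    (h : IsHeisenbergTable B α v) :
    IsHeisenbergTable B (-α) (v.reindex (Equiv.swap 0 1)) := by
  intro i j
  simp only [Basis.reindex_apply, Equiv.symm_swap, h _ _]
  fin_cases i <;> fin_cases j <;> simp [Equiv.swap_apply_def]

/-- The product sees only the coordinates along `e 0` and `e 1`. On `v` these form a triangular
block supported on `v 0`, `v 1`, whose determinant gives the constant. -/
theorem IsHeisenbergTable.of_repr {B : V →ₗ[ℝ] V →ₗ[ℝ] V} {e : Basis (Fin 5) ℝ V}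
    (h : IsHeisenbergTable B 1 e) {v : Basis (Fin 5) ℝ V} {r : ℝ} (h4 : e 4 = r • v 4)
    (h0 : ∀ i, i ≠ 0 → i ≠ 1 → e.repr (v i) 0 = 0) (h1 : ∀ i, i ≠ 1 → e.repr (v i) 1 = 0) :
    IsHeisenbergTable B (r * (e.repr (v 0) 0 * e.repr (v 1) 1)) v := by
  intro i j
  rw [h.apply, h4]
  generalize ha : (fun i => e.repr (v i) 0) = a at *
  generalize hb : (fun i => e.repr (v i) 1) = b at *
  have ha' i : e.repr (v i) 0 = a i := congrFun ha i
  have hb' i : e.repr (v i) 1 = b i := congrFun hb i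
  simp only [ha', hb'] at *
  have a2 := h0 2 (by decide) (by decide)
  have a3 := h0 3 (by decide) (by decide)
  have a4 := h0 4 (by decide) (by decide)
  have b0 := h1 0 (by decide)
  have b2 := h1 2 (by decide)
  have b3 := h1 3 (by decide)
  have b4 := h1 4 (by decide)
  fin_cases i <;> fin_cases j <;> simp [a2, a3, a4, b0, b2, b3, b4] <;>
    first | module | exact Or.inl (by ring)

/-- The Gram-Schmidt process applied to `e₅, e₃, e₄, e₁, e₂` gives an orthonormal basis in normal
form. -/
theorem IsHeisenbergTable.exists_orthonormal_ne {B : V →ₗ[ℝ] V →ₗ[ℝ] V} {e : Basis (Fin 5) ℝ V}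
    (h : IsHeisenbergTable B 1 e) :
    ∃ (α : ℝ) (v : Basis (Fin 5) ℝ V), α ≠ 0 ∧
      (∀ i j : Fin 5, inner ℝ (v i) (v j) = if i = j then (1 : ℝ) else 0) ∧
      IsHeisenbergTable B α v := by
  have hfin : FiniteDimensional ℝ V := e.finiteDimensional_of_finite
  -- `p` lists the order of orthogonalization: the derived algebra `e 4` first, then the other
  -- central vectors, then `e 0`, `e 1`. Triangularity keeps `v 4` on the line of `e 4` and `v 2`,
  -- `v 3` central.
  let p : Equiv.Perm (Fin 5) := ⟨![4, 2, 3, 0, 1], ![3, 4, 1, 2, 0], by decide, by decide⟩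
  let f : Basis (Fin 5) ℝ V := e.reindex p.symm
  let u : OrthonormalBasis (Fin 5) ℝ V := InnerProductSpace.gramSchmidtOrthonormalBasis
    (by rw [finrank_eq_card_basis e]) f
  have hu i : u i = InnerProductSpace.gramSchmidtNormed ℝ f i := by
    refine InnerProductSpace.gramSchmidtOrthonormalBasis_apply _ fun h0 => ?_
    have := InnerProductSpace.gramSchmidtNormed_unit_length (𝕜 := ℝ) i f.linearIndependent
    simp [h0] at this
  have hf : ∀ i j, i < j → e.repr (u i) (p j) = 0 := by
    intro i j hij
    have he : e.repr (u i) (p j) = f.repr (u i) j := by simp [f]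
    rw [he, hu, InnerProductSpace.gramSchmidtNormed, map_smul, Finsupp.smul_apply,
      InnerProductSpace.gramSchmidt_triangular hij, smul_zero]
  let v : Basis (Fin 5) ℝ V := u.toBasis.reindex p
  have hv i : v i = u (p.symm i) := by simp [v]
  have h0 : v 4 = e.repr (v 4) 4 • e 4 := by
    have hv4 : v 4 = u 0 := hv 4
    rw [hv4]
    conv_lhs => rw [← e.sum_repr (u 0)]
    have z0 : e.repr (u 0) 0 = 0 := hf 0 3 (by decide)
    have z1 : e.repr (u 0) 1 = 0 := hf 0 4 (by decide)
    have z2 : e.repr (u 0) 2 = 0 := hf 0 1 (by decide)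
    have z3 : e.repr (u 0) 3 = 0 := hf 0 2 (by decide)
    simp only [Fin.sum_univ_five, z0, z1, z2, z3, zero_smul, zero_add]
  have hr : e.repr (v 4) 4 ≠ 0 := fun hr => v.ne_zero 4 (by rw [h0, hr, zero_smul])
  have h4 : e 4 = (e.repr (v 4) 4)⁻¹ • v 4 := by
    conv_rhs => rw [h0, smul_smul]
    rw [← h0, inv_mul_cancel₀ hr, one_smul]
  have htab := h.of_repr h4
    (by
      intro i hi hi'
      rw [hv]
      refine hf _ 3 ?_
      revert i; decide)
    (by
      intro i hi
      rw [hv]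
      refine hf _ 4 ?_
      revert i; decide)
  refine ⟨_, v, fun hα => ?_, fun i j => ?_, htab⟩
  -- If the constant were zero, the product would vanish identically, yet `B (e 0) (e 1) = e 4 ≠ 0`.
  · have h01 := htab.apply (e 0) (e 1)
    rw [h 0 1, hα, zero_mul, zero_smul] at h01
    exact e.ne_zero 4 (by simpa using h01)
  · rw [hv, hv, orthonormal_iff_ite.1 u.orthonormal]
    simp

theorem IsHeisenbergTable.exists_orthonormal {B : V →ₗ[ℝ] V →ₗ[ℝ] V} {e : Basis (Fin 5) ℝ V}
    (h : IsHeisenbergTable B 1 e) :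
    ∃ (α : ℝ) (v : Basis (Fin 5) ℝ V), 0 < α ∧
      (∀ i j : Fin 5, inner ℝ (v i) (v j) = if i = j then (1 : ℝ) else 0) ∧
      IsHeisenbergTable B α v := by
  obtain ⟨α, v, hα, ho, ht⟩ := h.exists_orthonormal_ne
  rcases hα.lt_or_gt with hneg | hpos
  · refine ⟨-α, _, neg_pos.2 hneg, fun i j => ?_, ht.swap⟩
    rw [Basis.reindex_apply, Basis.reindex_apply, ho]
    simp
  · exact ⟨α, v, hpos, ho, ht⟩

end GramSchmidt

/-! ### The two implications. -/

section Main

variable {E : Type*} [NormedAddCommGroup E] [NormedSpace ℝ E] [FiniteDimensional ℝ E]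
  {G : Type*} [TopologicalSpace G] [ChartedSpace E G] [Group G] [LieGroup 𝓘(ℝ, E) ∞ G]

/-- The inner product that a Riemannian metric induces on the Lie algebra. -/
@[reducible]
def metricCore (g : SmoothMetric E G) : InnerProductSpace.Core ℝ (GroupLieAlgebra 𝓘(ℝ, E) G) where
  inner x y := g.inner 1 x y
  conj_inner_symm x y := g.symm 1 y x
  re_inner_nonneg x := by
    by_cases hx : x = 0
    · simp [hx]
    · exact (g.pos 1 x hx).le
  add_left x y z := by simp
  smul_left x y r := by simp
  definite x hx := by
    by_contra h
    exact (g.pos 1 x h).ne' hx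

theorem exists_orthonormal_hasHeisenbergBrackets (g : SmoothMetric E G)
    (hG : IsA31Plus2A1 (GroupLieAlgebra 𝓘(ℝ, E) G)) :
    ∃ (α : ℝ) (v : Basis (Fin 5) ℝ (GroupLieAlgebra 𝓘(ℝ, E) G)), 0 < α ∧
      (∀ i j : Fin 5, g.inner 1 (v i) (v j) = if i = j then 1 else 0) ∧
      HasHeisenbergBrackets α v := by
  obtain ⟨e, he⟩ := hG
  have hbr x y : ⁅x, y⁆ = bilinOfCoeff e (structureConst e) x y := by
    rw [GroupLieAlgebra.bracket_def, mlieBracket_mulInvariantVectorField e]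
    exact (leftTriv_one _).symm.trans (leftTriv_leftTrivSymm 1 _)
  -- Gram-Schmidt has to be run for the inner product of `g`, which is therefore installed locally.
  let _ : NormedAddCommGroup (GroupLieAlgebra 𝓘(ℝ, E) G) := (metricCore g).toNormedAddCommGroup
  let _ : InnerProductSpace ℝ (GroupLieAlgebra 𝓘(ℝ, E) G) := .ofCore (metricCore g).toCore
  have hT : IsHeisenbergTable (bilinOfCoeff e (structureConst e)) 1 e := fun i j => by
    rw [← hbr]; exact he i j
  obtain ⟨α, v, hα, ho, ht⟩ := hT.exists_orthonormal
  exact ⟨α, v, hα, ho, fun i j => (hbr _ _).trans (ht i j)⟩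

theorem inner_orthonormalMetric (v : Basis (Fin 5) ℝ (GroupLieAlgebra 𝓘(ℝ, E) G)) (i j : Fin 5) :
    (orthonormalMetric v).inner 1 (v i) (v j) = if i = j then 1 else 0 := by
  refine (sumSqForm_apply (coordForm v) 1 (v i) (v j)).trans ?_
  simp only [leftForm_apply, leftTriv_one, coordForm_apply, Basis.repr_self, Finsupp.single_apply,
    mul_ite, mul_one, mul_zero, Finset.sum_ite_eq, Finset.mem_univ, if_true]

theorem exists_adapted_of_hasRicci [CompleteSpace E]
    (hG : IsA31Plus2A1 (GroupLieAlgebra 𝓘(ℝ, E) G)) {T : TensorField02 E G} {g : SmoothMetric E G}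
    {t : ℝ} (hg : IsLeftInvariant g.inner) (ht : t ≠ 0) (h : HasRicci g (fun p => t ^ 2 • T p)) :
    ∃ (c : InnerProductSpace.Core ℝ (GroupLieAlgebra 𝓘(ℝ, E) G))
      (v : Basis (Fin 5) ℝ (GroupLieAlgebra 𝓘(ℝ, E) G)) (x y z : ℝ), IsAdaptedBasis c v ∧
        (∀ i j : Fin 5, T 1 (v i) (v j) = Matrix.diagonal ![x, y, 0, 0, z] i j) ∧
        x < 0 ∧ x = y ∧ y = -z := by
  obtain ⟨α, v, hα, ho, hb⟩ := exists_orthonormal_hasHeisenbergBrackets g hG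
  obtain ⟨nabla, hlc, hric⟩ := h
  -- The basis is orthonormal for `g` itself, so `η = 1`; the entries are those of the Ricci tensor
  -- divided by `t ^ 2`.
  refine ⟨metricCore g, v, -(α ^ 2 / 2) / t ^ 2, -(α ^ 2 / 2) / t ^ 2, (α ^ 2 / 2) / t ^ 2,
    ⟨α, 1, hα, one_pos, fun i j => (one_mul _).trans (ho i j), hb⟩, fun i j => ?_, ?_, rfl, by ring⟩
  · have h1 := hric 1 (v i) (v j)
    rw [hlc.ricci_eq_of_heisenberg hg ho hb, leftTriv_one, leftTriv_one, algRicci_heisenberg] at h1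
    have h2 : T 1 (v i) (v j) = (t ^ 2)⁻¹ * (t ^ 2 • T 1) (v i) (v j) := by
      rw [smul_apply, smul_apply, smul_eq_mul, inv_mul_cancel_left₀ (pow_ne_zero 2 ht)]
    rw [h2, ← h1]
    fin_cases i <;> fin_cases j <;> simp [Matrix.diagonal] <;> ring
  · rw [neg_div]
    exact neg_neg_of_pos (by positivity)

theorem exists_hasRicci_of_adapted [CompleteSpace E] {T : TensorField02 E G}
    (hT : IsLeftInvariant T) {c : InnerProductSpace.Core ℝ (GroupLieAlgebra 𝓘(ℝ, E) G)}
    {v : Basis (Fin 5) ℝ (GroupLieAlgebra 𝓘(ℝ, E) G)} {x y z : ℝ} (hv : IsAdaptedBasis c v)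
    (hd : ∀ i j : Fin 5, T 1 (v i) (v j) = Matrix.diagonal ![x, y, 0, 0, z] i j)
    (hx : x < 0) (hxy : x = y) (hyz : y = -z) :
    ∃ (g : SmoothMetric E G) (t : ℝ), IsLeftInvariant g.inner ∧ t ≠ 0 ∧
      HasRicci g (fun p => t ^ 2 • T p) := by
  obtain ⟨α, -, hα, -, -, hb⟩ := hv
  obtain rfl : z = -x := by rw [hxy, hyz, neg_neg]
  subst hxy
  have hpos : 0 < α ^ 2 / (2 * -x) := div_pos (by positivity) (by linarith)
  have hg : IsLeftInvariant (orthonormalMetric v).inner := isLeftInvariant_sumSqForm (coordForm v)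
  have hlc := isLeviCivita_frameConnection v
  -- `t` solves `t ^ 2 * x = -(α ^ 2 / 2)`, which is possible because `x < 0`.
  refine ⟨orthonormalMetric v, √(α ^ 2 / (2 * -x)), hg, (Real.sqrt_pos.2 hpos).ne', _, hlc,
    fun p u w => ?_⟩
  rw [hlc.ricci_eq_of_heisenberg hg (inner_orthonormalMetric v) hb, smul_apply, smul_apply,
    Real.sq_sqrt hpos.le, hT.eq_leftTriv p u w]
  let A : GroupLieAlgebra 𝓘(ℝ, E) G →ₗ[ℝ] GroupLieAlgebra 𝓘(ℝ, E) G →ₗ[ℝ] ℝ :=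
    LinearMap.mk₂ ℝ (fun a b => (α ^ 2 / (2 * -x)) • T 1 a b) (by intros; simp; ring)
      (by intros; simp; ring) (by intros; simp; ring) (by intros; simp; ring)
  have hA : algRicci v (bilinOfCoeff v (koszul (heisenbergCoeff α)))
      (bilinOfCoeff v (heisenbergCoeff α)) = A := by
    refine v.ext fun i => v.ext fun j => ?_
    rw [algRicci_heisenberg]
    change _ = (α ^ 2 / (2 * -x)) * T 1 (v i) (v j)
    rw [hd]
    have e : α ^ 2 / (2 * -x) * x = -(α ^ 2 / 2) := by
      have hx0 := hx.ne
      field_simp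
    generalize α ^ 2 / (2 * -x) = s at e ⊢
    fin_cases i <;> fin_cases j <;> simp [Matrix.diagonal] <;> linarith
  exact congrArg (fun B => B (leftTriv p u) (leftTriv p w)) hA

end Main

end RicciLie

end

theorem mainTheorem8
    {G : Type*} [TopologicalSpace G] [ChartedSpace (EuclideanSpace ℝ (Fin 5)) G] [Group G]
    [LieGroup 𝓘(ℝ, EuclideanSpace ℝ (Fin 5)) ∞ G]
    (hG : RicciLie.IsA31Plus2A1 (GroupLieAlgebra 𝓘(ℝ, EuclideanSpace ℝ (Fin 5)) G))
    (T : RicciLie.TensorField02 (EuclideanSpace ℝ (Fin 5)) G)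
    (hTsymm : RicciLie.IsSymmetricTensor T) (hTinv : RicciLie.IsLeftInvariant T) :
    (∃ (g : RicciLie.SmoothMetric (EuclideanSpace ℝ (Fin 5)) G) (t : ℝ),
        RicciLie.IsLeftInvariant g.inner ∧ t ≠ 0 ∧
          RicciLie.HasRicci g (fun p => t ^ 2 • T p)) ↔
      ∃ (c : InnerProductSpace.Core ℝ (GroupLieAlgebra 𝓘(ℝ, EuclideanSpace ℝ (Fin 5)) G))
        (v : Module.Basis (Fin 5) ℝ (GroupLieAlgebra 𝓘(ℝ, EuclideanSpace ℝ (Fin 5)) G))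
        (x y z : ℝ),
        RicciLie.IsAdaptedBasis c v ∧
          (∀ i j : Fin 5, T 1 (v i) (v j) = Matrix.diagonal ![x, y, 0, 0, z] i j) ∧
          x < 0 ∧ x = y ∧ y = -z := by
  constructor
  · rintro ⟨g, t, hg, ht, h⟩
    exact RicciLie.exists_adapted_of_hasRicci hG hg ht h
  · rintro ⟨c, v, x, y, z, hv, hd, hx, hxy, hyz⟩
    exact RicciLie.exists_hasRicci_of_adapted hTinv hv hd hx hxy hyz
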